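/- Let $B$ be a complete Boolean algebra. In the cut and choose game on $B$, player I first plays a nonzero $p\in B$, and then in each round $i<\omega$ player I plays some $b_i\in B$ and player II answers with some $r_i\in\{0,1\}$. Player II wins the run if $$p\wedge\bigwedge_{i<\omega,\,r_i=1}b_i-\bigvee_{i<\omega,\,r_i=0}b_i\neq 0 .$$ Theorem. If player II has a winning strategy in the cut and choose game on $B$, then $B$ is semiproper. That is, for every sufficiently large regular cardinal $\theta$, every countable elementary submodel $N\prec(H_\theta,\in)$ with $B\in N$ and every nonzero $p\in B\cap N$, there is a nonzero $q\le p$ in $B$ which is $(N,B)$-semigeneric, i.e. $q\Vdash N[\dot G]\cap\omega_1=N\cap\omega_1$: for every $B$-name $\dot\alpha\in N$ for an ordinal below $\omega_1$, $q\le\bigvee_{\alpha\in N\cap\omega_1}[\![\dot\alpha=\alpha]\!]$. Here $H_\theta$ is the collection of sets whose transitive closure has cardinality less than $\theta$, and a $B$-name $\dot\alpha$ for an ordinal below $\omega_1$ is given by its Boolean values, i.e. by a function $\alpha\mapsto[\![\dot\alpha=\alpha]\!]$ from $\omega_1$ to $B$ with pairwise disjoint values whose join is $1$. -/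

import Mathlib

universe u

namespace CutChoose

open Cardinal Ordinal FirstOrder

/-! ### The cut and choose game -/

section Game

variable {B : Type u} [CompleteBooleanAlgebra B]

/-- The element of `B` decided by a run of the cut and choose game in which player I plays `p` and
`b 0, b 1, …` and player II answers `r 0, r 1, …`, namely
`p ∧ ⋀ {b i | r i = 1} - ⋁ {b i | r i = 0}`. -/
def outcome (p : B) (b : ℕ → B) (r : ℕ → Bool) : B :=
  (p ⊓ ⨅ (i : ℕ) (_ : r i = true), b i) \ ⨆ (i : ℕ) (_ : r i = false), b i

variable (B) in
/-- A strategy for player II: the answer to the last question, given the first move `p` of player I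
and the nonempty list of all the questions `b 0, …, b i` asked so far. -/
abbrev StrategyII : Type u := B → List B → Bool

/-- The answers `r 0, r 1, …` that the strategy `σ` gives against the moves `p, b 0, b 1, …`. -/
def StrategyII.answers (σ : StrategyII B) (p : B) (b : ℕ → B) (i : ℕ) : Bool :=
  σ p ((List.range (i + 1)).map b)

/-- `σ` is winning for II: whatever (nonzero) `p` and `b 0, b 1, …` player I plays, the answers of
`σ` are compatible with `p`. -/
def StrategyII.IsWinning (σ : StrategyII B) : Prop :=
  ∀ p : B, p ≠ ⊥ → ∀ b : ℕ → B, outcome p b (σ.answers p b) ≠ ⊥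

end Game

/-! ### The structures `(H_θ, ∈)` and their elementary submodels -/

/-- The relation symbols of the language of set theory: a single binary one. -/
inductive SetRel : ℕ → Type
  | mem : SetRel 2

/-- The first-order language of set theory. -/
def setLang : Language := ⟨fun _ => Empty, SetRel⟩

/-- `H_θ`: the sets whose transitive closure has cardinality less than `θ`, that is, the sets
included in a transitive set of cardinality less than `θ`. -/
def H (θ : Cardinal.{u}) : Set ZFSet.{u} :=
  {x | ∃ t : ZFSet.{u}, t.IsTransitive ∧ x ⊆ t ∧ t.card < θ}

/-- `H_θ` as a structure for the language of set theory, with the true membership relation. -/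
instance structureH (θ : Cardinal.{u}) : setLang.Structure (H θ) where
  funMap := fun f => nomatch f
  RelMap | .mem => fun x => (x 0 : ZFSet.{u}) ∈ (x 1 : ZFSet.{u})

/-- An elementary submodel of `H_θ`, seen as a collection of sets. -/
def elems {θ : Cardinal.{u}} (N : setLang.ElementarySubstructure (H θ)) : Set ZFSet.{u} :=
  Subtype.val '' (N : Set (H θ))

/-! ### Complete Boolean algebras and names for countable ordinals as sets -/

section Semiproper

variable {B : Type u} [CompleteBooleanAlgebra B]

/-- The set of ordered pairs `(e a, e b)` with `a ≤ b`: when `e` is injective, this is the complete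
Boolean algebra `B`, carried over along `e` to a set of sets. Its domain is the set of all `e a`,
and the Boolean operations are determined by the order. -/
noncomputable def codeAlgebra (e : B → ZFSet.{u}) : ZFSet.{u} :=
  ZFSet.range fun x : {x : B × B // x.1 ≤ x.2} => ZFSet.pair (e x.1.1) (e x.1.2)

/-- A `B`-name for an ordinal below `ω₁`, given by the Boolean values `f α = ⟦name = α⟧`, `α < ω₁`:
these are pairwise disjoint with join `1`. -/
structure IsCountableOrdinalName (f : Set.Iio (ω₁ : Ordinal.{u}) → B) : Prop where
  disjoint : Pairwise fun α β => Disjoint (f α) (f β)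
  iSup_eq_top : ⨆ α, f α = ⊤

/-- The name `f` as a set: the function (set of ordered pairs) sending `α < ω₁` to `e (f α)`. -/
noncomputable def codeName (e : B → ZFSet.{u}) (f : Set.Iio (ω₁ : Ordinal.{u}) → B) : ZFSet.{u} :=
  ZFSet.range fun α : Set.Iio (ω₁ : Ordinal.{u}) =>
    ZFSet.pair (α : Ordinal.{u}).toZFSet (e (f α))

/-- `q` is `(N, B)`-semigeneric, i.e. `q ⊩ N[G] ∩ ω₁ = N ∩ ω₁`: for each name `f ∈ N` for a
countable ordinal, `q` forces that the ordinal named belongs to `N`. -/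
def IsSemigeneric (e : B → ZFSet.{u}) (N : Set ZFSet.{u}) (q : B) : Prop :=
  ∀ f : Set.Iio (ω₁ : Ordinal.{u}) → B, IsCountableOrdinalName f → codeName e f ∈ N →
    q ≤ ⨆ (α : Set.Iio (ω₁ : Ordinal.{u})) (_ : (α : Ordinal.{u}).toZFSet ∈ N), f α

variable (B) in
/-- `B` is semiproper: for all sufficiently large regular `θ` and all countable `N ≺ H_θ` containing
the algebra, each nonzero `p ∈ B ∩ N` has a nonzero extension `q ≤ p` that is semigeneric for `N`.
As elementary submodels consist of sets, this is said for every copy of `B` whose underlying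
collection is a set of sets. -/
def IsSemiproper : Prop :=
  ∀ e : B → ZFSet.{u}, Function.Injective e →
    ∃ θ₀ : Cardinal.{u}, ∀ θ : Cardinal.{u}, θ₀ ≤ θ → θ.IsRegular →
      ∀ N : setLang.ElementarySubstructure (H θ), (elems N).Countable →
        codeAlgebra e ∈ elems N →
          ∀ p : B, p ≠ ⊥ → e p ∈ elems N →
            ∃ q : B, q ≠ ⊥ ∧ q ≤ p ∧ IsSemigeneric e (elems N) q

end Semiproper

end CutChoose

namespace CutChoose

open Cardinal

/-! ### Bernstein sets in the Cantor space. -/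

section Bernstein

/-! A winning strategy matters only through its tree of positions: a position can be extended to
decide any given element of the algebra, and every chain of positions has a nonzero lower bound.
These properties are first-order over `H θ` (`IsStrategyTree`), so `N` contains a tree with them,
although the given strategy need not lie in `N`.

The heart is `exists_extension_le`: every position extends to one that forces a value of a given
name for a countable ordinal, although only yes-or-no questions can be asked. Code the countable
ordinals by distinct reals from a Bernstein set (`exists_bernstein`) and ask for the bits of the
real coding the named ordinal. If no extension forced a value, any position could be extended to two
positions that disagree on some bit. This gives a Cantor tree of runs, each deciding a different
real, and all these reals would lie in the Bernstein set, which includes no such perfect set.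

By elementarity the extension and the value can be taken in `N` (`IsStrategyTree.exists_value_mem`).
Treating the names in `N` one after another gives an increasing sequence of positions in `N`. The
sequence is built outside `N`, but its range belongs to `H θ`, so it has a nonzero lower bound, and
this is semigeneric. -/

theorem exists_injective_forall_mem {ι α : Type u} (F : ι → Set α) (hF : ∀ i, #ι ≤ #(F i)) :
    ∃ g : ι → α, Function.Injective g ∧ ∀ i, g i ∈ F i := by
  obtain ⟨r, hr, hord⟩ := Cardinal.exists_ord_eq ι
  -- The well-order `r` has the least possible type, so fewer than `#ι` choices precede stage `i`
  -- and they cannot exhaust `F i`.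
  have key : ∀ (i : ι) (ih : ∀ j, r j i → α), ∃ y ∈ F i, ∀ j (h : r j i), y ≠ ih j h := by
    intro i ih
    by_contra! hcon
    have hsub : F i ⊆ Set.range fun j : {j // r j i} => ih j.1 j.2 := by
      intro y hy
      obtain ⟨j, h, e⟩ := hcon y hy
      exact ⟨⟨j, h⟩, e.symm⟩
    have h1 : #(F i) ≤ #{j // r j i} := (mk_le_mk_of_subset hsub).trans mk_range_le
    have h2 : #{j // r j i} < #ι := by
      have := Cardinal.card_typein_lt (r := r) i hord
      rwa [Ordinal.card_typein] at this
    exact absurd (hF i) (not_le.2 (h1.trans_lt h2))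
  choose G hG1 hG2 using key
  let g : ι → α := hr.wf.fix G
  have hg : ∀ i, g i = G i fun j _ => g j := fun i => hr.wf.fix_eq G i
  refine ⟨g, fun i j hij => ?_, fun i => by rw [hg]; exact hG1 _ _⟩
  rcases trichotomous_of r i j with h | h | h
  · exact absurd (hg j ▸ hij.symm : G j (fun k _ => g k) = g i) (hG2 j _ i h)
  · exact h
  · exact absurd (hg i ▸ hij : G i (fun k _ => g k) = g j) (hG2 i _ j h)

/-- The first `n` terms of `z`, the last one first. -/
def initialSegment (z : ℕ → Bool) : ℕ → List Bool
  | 0 => []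
  | n + 1 => z n :: initialSegment z n

@[simp] theorem length_initialSegment (z : ℕ → Bool) (n : ℕ) :
    (initialSegment z n).length = n := by
  induction n with
  | zero => rfl
  | succ n ih => simp [initialSegment, ih]

theorem initialSegment_congr {z z' : ℕ → Bool} {n : ℕ} (h : ∀ k < n, z k = z' k) :
    initialSegment z n = initialSegment z' n := by
  induction n with
  | zero => rfl
  | succ n ih =>
    rw [initialSegment, initialSegment, h n n.lt_succ_self, ih fun k hk => h k (hk.trans n.lt_succ_self)]

/-- The transformation of the Cantor space whose `n`-th output bit is computed by `D` from the
first `n + 1` input bits. -/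
def treeMap (D : List Bool → Bool) (z : ℕ → Bool) (n : ℕ) : Bool :=
  D (initialSegment z (n + 1))

/-- A set of size continuum which includes no range of an injective `treeMap D`. -/
theorem exists_bernstein :
    ∃ x : (ℕ → Bool) → ℕ → Bool, Function.Injective x ∧
      ∀ D, Function.Injective (treeMap D) → ∃ z, ∀ y, x y ≠ treeMap D z := by
  classical
  -- The points chosen at `(D, true)` make up the Bernstein set, those at `(D, false)` are kept out
  -- of it. `Set.univ` only keeps every set of size continuum.
  let F : (List Bool → Bool) × Bool → Set (ℕ → Bool) := fun i =>
    if Function.Injective (treeMap i.1) then Set.range (treeMap i.1) else Set.univ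
  have hJ : #(List Bool → Bool) = 𝔠 := by simp
  have hC : #(ℕ → Bool) = 𝔠 := by simp
  have hι : #((List Bool → Bool) × Bool) = 𝔠 := by
    rw [mk_prod]; simp [hJ]
  obtain ⟨g, hg, hgF⟩ := exists_injective_forall_mem F fun i => by
    rw [hι]
    by_cases h : Function.Injective (treeMap i.1)
    · simp only [F, if_pos h]
      rw [mk_range_eq _ h, hC]
    · simp only [F, if_neg h]
      rw [mk_univ, hC]
  obtain ⟨E⟩ := Cardinal.eq.1 (hC.trans hJ.symm)
  refine ⟨fun y => g (E y, true), fun y y' h => E.injective (Prod.ext_iff.1 (hg h)).1,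
    fun D hD => ?_⟩
  have := hgF (D, false)
  simp only [F, if_pos hD] at this
  obtain ⟨z, hz⟩ := this
  refine ⟨z, fun y h => ?_⟩
  simpa using hg (h.trans hz)

end Bernstein

/-! ### Forcing the value of a name by yes-or-no decisions. -/

section Decide

variable {B : Type u} [CompleteBooleanAlgebra B] {S : Type*} [Preorder S]

theorem exists_monotone_run (R : ℕ → S → Prop) (h : ∀ n s, ∃ t, s ≤ t ∧ R n t) (s : S) :
    ∃ u : ℕ → S, u 0 = s ∧ Monotone u ∧ ∀ n, R n (u (n + 1)) := by
  choose g hg hR using h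
  exact ⟨fun n => Nat.rec s (fun k t => g k t) n, rfl, monotone_nat_of_le_succ fun n => hg _ _,
    fun n => hR _ _⟩

variable {Y : Type*} (f : Y → B) (x : Y → ℕ → Bool)

/-- The truth value of the statement that the `n`-th bit of the real with the name `f` is `r`. -/
def bitValue (n : ℕ) (r : Bool) : B :=
  if r then ⨆ (α : Y) (_ : x α n = true), f α else (⨆ (α : Y) (_ : x α n = true), f α)ᶜ

theorem disjoint_bitValue {n : ℕ} {r r' : Bool} (h : r ≠ r') :
    Disjoint (bitValue f x n r) (bitValue f x n r') := by
  cases r <;> cases r' <;> simp_all [bitValue, disjoint_compl_left, disjoint_compl_right]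

variable {f x}

/-- An element that decides all bits is compatible only with values whose code has these bits. -/
theorem eq_of_le_bitValue (hdisj : Pairwise fun α β => Disjoint (f α) (f β)) {q : B}
    {r : ℕ → Bool} (hq : ∀ n, q ≤ bitValue f x n (r n)) {α : Y} (hα : q ⊓ f α ≠ ⊥) : x α = r := by
  funext n
  by_contra hne
  apply hα
  have hle : f α ≤ bitValue f x n (x α n) := by
    cases hx : x α n
    · simp only [bitValue, Bool.false_eq_true, if_false, le_compl_iff_disjoint_right]
      refine disjoint_iSup₂_iff.2 fun β hβ => hdisj ?_
      rintro rfl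
      simp_all
    · exact le_iSup₂_of_le α hx le_rfl
  exact ((disjoint_bitValue f x (Ne.symm hne)).mono (hq n) hle).eq_bot

theorem exists_inf_ne_bot (htop : ⨆ α, f α = ⊤) {q : B} (hq : q ≠ ⊥) : ∃ α, q ⊓ f α ≠ ⊥ := by
  by_contra! h
  apply hq
  rw [← inf_top_eq q, ← htop, inf_iSup_eq]
  simp [h]

theorem exists_extension_le (D : S → Set B) (hmono : Monotone D)
    (hchain : ∀ u : ℕ → S, Monotone u → ∃ q : B, q ≠ ⊥ ∧ ∀ n, ∀ c ∈ D (u n), q ≤ c)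
    (hdec : ∀ (s : S) (b : B), ∃ t, s ≤ t ∧ ∃ c ∈ D t, c ≤ b ∨ c ≤ bᶜ)
    (hdisj : Pairwise fun α β => Disjoint (f α) (f β)) (htop : ⨆ α, f α = ⊤)
    (hx : Function.Injective x)
    (hbern : ∀ E, Function.Injective (treeMap E) → ∃ z, ∀ y, x y ≠ treeMap E z) (s : S) :
    ∃ t, s ≤ t ∧ ∃ α, ∃ c ∈ D t, c ≤ f α := by
  by_contra! hno
  have hbit : ∀ n t, ∃ t', t ≤ t' ∧ ∃ r, ∃ c ∈ D t', c ≤ bitValue f x n r := by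
    intro n t
    obtain ⟨t', h, c, hc, hcb | hcb⟩ := hdec t (bitValue f x n true)
    · exact ⟨t', h, true, c, hc, hcb⟩
    · exact ⟨t', h, false, c, hc, by simpa [bitValue] using hcb⟩
  have hrun : ∀ t, ∃ u : ℕ → S, u 0 = t ∧ Monotone u ∧ ∃ r : ℕ → Bool, ∀ n,
      ∃ c ∈ D (u (n + 1)), c ≤ bitValue f x n (r n) := by
    intro t
    obtain ⟨u, h0, hu, h⟩ := exists_monotone_run _ hbit t
    choose r hr using h
    exact ⟨u, h0, hu, r, hr⟩
  -- The lower bound of a run deciding all bits meets some `f α`, so the decided real is a code `x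
  -- α`.
  have hreal : ∀ t, ∃ u : ℕ → S, u 0 = t ∧ Monotone u ∧ ∃ (q : B) (α : Y),
      (∀ n, ∀ c ∈ D (u n), q ≤ c) ∧ q ⊓ f α ≠ ⊥ ∧
        ∀ n, ∃ c ∈ D (u (n + 1)), c ≤ bitValue f x n (x α n) := by
    intro t
    obtain ⟨u, h0, hu, r, hr⟩ := hrun t
    obtain ⟨q, hq, hqu⟩ := hchain u hu
    obtain ⟨α, hα⟩ := exists_inf_ne_bot htop hq
    have : x α = r := eq_of_le_bitValue hdisj (q := q) (fun n => by
      obtain ⟨c, hc, hcb⟩ := hr n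
      exact (hqu _ c hc).trans hcb) hα
    exact ⟨u, h0, hu, q, α, hqu, hα, this ▸ hr⟩
  have hsplit : ∀ t : {t // s ≤ t}, ∃ n, ∀ b, ∃ t' : {t // s ≤ t}, t ≤ t' ∧
      ∃ c ∈ D t'.1, c ≤ bitValue f x n b := by
    rintro ⟨t, hst⟩
    obtain ⟨u, hu0, hu, q, α, -, -, hα⟩ := hreal t
    -- Since no position above `s` forces a value, `w` excludes `α`. A run above `w` must then
    -- produce another real than `x α`.
    obtain ⟨w, htw, c, hc, hcα⟩ := hdec t (f α)
    have hcα : c ≤ (f α)ᶜ := hcα.resolve_left (hno w (hst.trans htw) α c hc)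
    obtain ⟨v, hv0, hv, q', β, hq', hβq, hβ⟩ := hreal w
    have hne : α ≠ β := by
      rintro rfl
      have h1 : q' ≤ (f α)ᶜ := (hq' 0 c (by rwa [hv0])).trans hcα
      exact hβq (le_compl_iff_disjoint_right.1 h1).eq_bot
    obtain ⟨n, hn⟩ := Function.ne_iff.1 (hx.ne hne)
    have ht1 : t ≤ u (n + 1) := hu0 ▸ hu (Nat.zero_le _)
    have ht2 : t ≤ v (n + 1) := htw.trans (hv0 ▸ hv (Nat.zero_le _))
    refine ⟨n, fun b => ?_⟩
    by_cases hb : x α n = b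
    · exact ⟨⟨_, hst.trans ht1⟩, ht1, hb ▸ hα n⟩
    · have hb' : x β n = b := by
        cases b <;> cases h : x α n <;> simp_all
      exact ⟨⟨_, hst.trans ht2⟩, ht2, hb' ▸ hβ n⟩
  choose m sp hsp hspm using hsplit
  have hbit' : ∀ (t : {t // s ≤ t}) n, ∃ t' : {t // s ≤ t}, t ≤ t' ∧
      ∃ r, ∃ c ∈ D t'.1, c ≤ bitValue f x n r := by
    rintro ⟨t, hst⟩ n
    obtain ⟨t', h, h'⟩ := hbit n t
    exact ⟨⟨t', hst.trans h⟩, h, h'⟩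
  choose dec hdecle val hval using hbit'
  -- At each node the new input bit picks a side of a split, and then the output bit indexed by the
  -- level is decided. Hence that output bit depends on one more input bit than its index, as in
  -- `treeMap`.
  let T : List Bool → {t // s ≤ t} := fun l =>
    List.rec ⟨s, le_rfl⟩ (fun b l t => dec (sp t b) l.length) l
  have hT : ∀ b l, T (b :: l) = dec (sp (T l) b) l.length := fun _ _ => rfl
  have hTle : ∀ b l, sp (T l) b ≤ T (b :: l) := fun b l => hdecle _ _
  let E : List Bool → Bool := fun l =>
    List.casesOn l false fun b l => val (sp (T l) b) l.length
  have hE : ∀ b l, ∃ c ∈ D (T (b :: l)).1, c ≤ bitValue f x l.length (E (b :: l)) :=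
    fun b l => hval _ _
  have hbranch : ∀ z : ℕ → Bool, ∃ q : B, q ≠ ⊥ ∧ (∀ n, q ≤ bitValue f x n (treeMap E z n)) ∧
      ∀ k, q ≤ bitValue f x (m (T (initialSegment z k))) (z k) := by
    intro z
    have hm : Monotone fun n => (T (initialSegment z n)).1 :=
      monotone_nat_of_le_succ fun n => (hsp _ _).trans (hTle _ _)
    obtain ⟨q, hq, hqu⟩ := hchain _ hm
    refine ⟨q, hq, fun n => ?_, fun k => ?_⟩
    · obtain ⟨c, hc, hcb⟩ := hE (z n) (initialSegment z n)
      rw [length_initialSegment] at hcb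
      exact (hqu (n + 1) c hc).trans hcb
    · obtain ⟨c, hc, hcb⟩ := hspm (T (initialSegment z k)) (z k)
      exact (hqu (k + 1) c (hmono (hTle _ _) hc)).trans hcb
  have huniq : ∀ (q : B) n r r', q ≠ ⊥ → q ≤ bitValue f x n r → q ≤ bitValue f x n r' → r = r' := by
    intro q n r r' hq h h'
    by_contra hne
    exact hq (disjoint_self.1 ((disjoint_bitValue f x hne).mono h h'))
  have hinj : Function.Injective (treeMap E) := by
    intro z z' hzz
    by_contra hne
    have hex : ∃ k, z k ≠ z' k := Function.ne_iff.1 hne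
    classical
    have hk := Nat.find_spec hex
    have hlt : ∀ j < Nat.find hex, z j = z' j := fun j hj => not_not.1 (Nat.find_min hex hj)
    obtain ⟨q, hq, hq1, hq2⟩ := hbranch z
    obtain ⟨q', hq', hq1', hq2'⟩ := hbranch z'
    apply hk
    -- At the first difference both branches are at the same node, and the output bit split there
    -- equals the input bit, so equal outputs give equal inputs.
    have e := initialSegment_congr hlt
    have e1 := huniq q _ _ _ hq (hq1 _) (hq2 (Nat.find hex))
    have e2 := huniq q' _ _ _ hq' (hq1' _) (hq2' (Nat.find hex))
    rw [← e1, ← e2, e, hzz]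
  obtain ⟨z, hz⟩ := hbern E hinj
  obtain ⟨q, hq, hq1, -⟩ := hbranch z
  obtain ⟨α, hα⟩ := exists_inf_ne_bot htop hq
  exact hz α (eq_of_le_bitValue hdisj hq1 hα)

end Decide

end CutChoose

namespace CutChoose

open Cardinal FirstOrder

/-! ### First-order definability over `H θ`. -/

section Definability

variable {θ : Cardinal.{u}}

/-- The relation `P` on `H θ` is definable without parameters, its variables being indexed by `Γ`. -/
def IsFirstOrder {Γ : Type} (P : (Γ → H θ) → Prop) : Prop :=
  ∃ φ : setLang.Formula Γ, ∀ v, φ.Realize v ↔ P v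

namespace IsFirstOrder

variable {Γ : Type} {P Q : (Γ → H θ) → Prop}

theorem mem (i j : Γ) : IsFirstOrder fun v : Γ → H θ => (v i).1 ∈ (v j).1 := by
  let R : setLang.Relations 2 := SetRel.mem
  exact ⟨R.formula₂ (.var i) (.var j), fun v => Language.Formula.realize_rel₂⟩

theorem eq (i j : Γ) : IsFirstOrder fun v : Γ → H θ => v i = v j :=
  ⟨Language.Term.equal (.var i) (.var j), fun v => by simp⟩

theorem not (h : IsFirstOrder P) : IsFirstOrder fun v => ¬ P v := by
  obtain ⟨φ, hφ⟩ := h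
  exact ⟨φ.not, fun v => by rw [Language.Formula.realize_not, hφ]⟩

theorem imp (h : IsFirstOrder P) (h' : IsFirstOrder Q) : IsFirstOrder fun v => P v → Q v := by
  obtain ⟨φ, hφ⟩ := h
  obtain ⟨ψ, hψ⟩ := h'
  exact ⟨φ.imp ψ, fun v => by rw [Language.Formula.realize_imp, hφ, hψ]⟩

theorem and (h : IsFirstOrder P) (h' : IsFirstOrder Q) : IsFirstOrder fun v => P v ∧ Q v := by
  obtain ⟨φ, hφ⟩ := h
  obtain ⟨ψ, hψ⟩ := h'
  exact ⟨φ ⊓ ψ, fun v => by rw [Language.Formula.realize_inf, hφ, hψ]⟩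

theorem or (h : IsFirstOrder P) (h' : IsFirstOrder Q) : IsFirstOrder fun v => P v ∨ Q v := by
  obtain ⟨φ, hφ⟩ := h
  obtain ⟨ψ, hψ⟩ := h'
  exact ⟨φ ⊔ ψ, fun v => by rw [Language.Formula.realize_sup, hφ, hψ]⟩

theorem ex {P : (Γ → H θ) → H θ → Prop}
    (h : IsFirstOrder fun w : Option Γ → H θ => P (fun i => w (some i)) (w none)) :
    IsFirstOrder fun v => ∃ x, P v x := by
  obtain ⟨φ, hφ⟩ := h
  refine ⟨Language.Formula.iExs Unit
    (φ.relabel fun o : Option Γ => o.elim (Sum.inr ()) Sum.inl), fun v => ?_⟩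
  rw [Language.Formula.realize_iExs]
  simp only [Language.Formula.realize_relabel, hφ]
  exact ⟨fun ⟨i, hi⟩ => ⟨i (), hi⟩, fun ⟨x, hx⟩ => ⟨fun _ => x, hx⟩⟩

theorem all {P : (Γ → H θ) → H θ → Prop}
    (h : IsFirstOrder fun w : Option Γ → H θ => P (fun i => w (some i)) (w none)) :
    IsFirstOrder fun v => ∀ x, P v x := by
  obtain ⟨φ, hφ⟩ := (ex (P := fun v x => ¬ P v x) h.not).not
  exact ⟨φ, fun v => by rw [hφ]; push Not; rfl⟩

/-- The Tarski–Vaught property: this is the form in which elementarity is used. -/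
theorem exists_mem {P : (Option Γ → H θ) → Prop} (h : IsFirstOrder P)
    (N : setLang.ElementarySubstructure (H θ)) (v : Γ → H θ) (hv : ∀ i, v i ∈ N) (x : H θ)
    (hx : P fun o => o.elim x v) : ∃ y ∈ N, P fun o => o.elim y v := by
  obtain ⟨φ, hφ⟩ := h
  let ψ : setLang.Formula Γ := Language.Formula.iExs Unit
    (φ.relabel fun o : Option Γ => o.elim (Sum.inr ()) Sum.inl)
  let w : Γ → N := fun i => ⟨v i, hv i⟩
  have h1 : ψ.Realize v := by
    rw [Language.Formula.realize_iExs]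
    refine ⟨fun _ => x, ?_⟩
    rw [Language.Formula.realize_relabel, hφ]
    convert hx using 2 with o
    cases o <;> rfl
  have h2 : ψ.Realize w := (N.subtype.map_formula ψ w).1 h1
  rw [Language.Formula.realize_iExs] at h2
  obtain ⟨i, hi⟩ := h2
  rw [Language.Formula.realize_relabel, ← N.subtype.map_formula, hφ] at hi
  refine ⟨i (), (i ()).2, ?_⟩
  convert hi using 2 with o
  cases o <;> rfl

end IsFirstOrder

theorem mem_H_of_mem {x y : ZFSet.{u}} (hy : y ∈ H θ) (hxy : x ∈ y) : x ∈ H θ := by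
  obtain ⟨t, ht, hyt, hc⟩ := hy
  exact ⟨t, ht, ht _ (hyt hxy), hc⟩

theorem mem_H_of_subset {x y : ZFSet.{u}} (hy : y ∈ H θ) (hxy : x ⊆ y) : x ∈ H θ := by
  obtain ⟨t, ht, hyt, hc⟩ := hy
  exact ⟨t, ht, fun _ h => hyt (hxy h), hc⟩

theorem exists_forall_mem_H (x : ZFSet.{u}) : ∃ θ₀ : Cardinal.{u}, ∀ θ, θ₀ ≤ θ → x ∈ H θ :=
  ⟨Order.succ (ZFSet.vonNeumann x.rank).card, fun _ h =>
    ⟨_, ZFSet.isTransitive_vonNeumann _, ZFSet.subset_vonNeumann_self x,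
      Order.succ_le_iff.1 h⟩⟩

theorem mem_H_of_pair_mem {x y a : ZFSet.{u}} (ha : a ∈ H θ) (h : ZFSet.pair x y ∈ a) :
    x ∈ H θ ∧ y ∈ H θ := by
  have h1 : ({x, y} : ZFSet) ∈ H θ := mem_H_of_mem (mem_H_of_mem ha h) (by simp [ZFSet.pair])
  exact ⟨mem_H_of_mem h1 (by simp), mem_H_of_mem h1 (by simp)⟩

/-- `z = {x, y}`. -/
theorem isFirstOrder_eq_pair {Γ : Type} (k i j : Γ) :
    IsFirstOrder fun v : Γ → H θ => (v k).1 = {(v i).1, (v j).1} := by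
  have : IsFirstOrder fun v : Γ → H θ =>
      ∀ u : H θ, (u.1 ∈ (v k).1 → u = v i ∨ u = v j) ∧ (u = v i ∨ u = v j → u.1 ∈ (v k).1) :=
    .all (.and (.imp (.mem _ _) (.or (.eq _ _) (.eq _ _)))
      (.imp (.or (.eq _ _) (.eq _ _)) (.mem _ _)))
  convert this using 2 with v
  constructor
  · intro h u
    rw [h]
    simp [Subtype.ext_iff]
  · intro h
    ext u
    rw [ZFSet.mem_pair]
    constructor
    · intro hu
      simpa [Subtype.ext_iff] using (h ⟨u, mem_H_of_mem (v k).2 hu⟩).1 hu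
    · rintro (rfl | rfl)
      · exact (h (v i)).2 (.inl rfl)
      · exact (h (v j)).2 (.inr rfl)

/-- `(x, y) ∈ a`. -/
theorem isFirstOrder_pair_mem {Γ : Type} (i j k : Γ) :
    IsFirstOrder fun v : Γ → H θ => ZFSet.pair (v i).1 (v j).1 ∈ (v k).1 := by
  have : IsFirstOrder fun v : Γ → H θ => ∃ z : H θ, z.1 ∈ (v k).1 ∧ ∃ s d : H θ,
      s.1 = {(v i).1, (v i).1} ∧ d.1 = {(v i).1, (v j).1} ∧ z.1 = {s.1, d.1} :=
    .ex (.and (.mem _ _) (.ex (.ex (.and (isFirstOrder_eq_pair _ _ _)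
      (.and (isFirstOrder_eq_pair _ _ _) (isFirstOrder_eq_pair _ _ _))))))
  convert this using 2 with v
  constructor
  · intro h
    have hz := mem_H_of_mem (v k).2 h
    refine ⟨⟨_, hz⟩, h, ⟨{(v i).1}, mem_H_of_mem hz (by simp [ZFSet.pair])⟩,
      ⟨{(v i).1, (v j).1}, mem_H_of_mem hz (by simp [ZFSet.pair])⟩, ?_, rfl, rfl⟩
    ext; simp
  · rintro ⟨z, hz, s, d, hs, hd, h⟩
    have : s.1 = {(v i).1} := by rw [hs]; ext; simp
    rw [h, this, hd] at hz
    exact hz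

theorem isFirstOrder_subset {Γ : Type} (i j : Γ) :
    IsFirstOrder fun v : Γ → H θ => (v i).1 ⊆ (v j).1 := by
  have : IsFirstOrder fun v : Γ → H θ => ∀ u : H θ, u.1 ∈ (v i).1 → u.1 ∈ (v j).1 :=
    .all (.imp (.mem _ _) (.mem _ _))
  convert this using 2 with v
  exact ⟨fun h u hu => h hu, fun h u hu => h ⟨u, mem_H_of_mem (v i).2 hu⟩ hu⟩

end Definability

end CutChoose

namespace CutChoose

open Cardinal Ordinal FirstOrder

/-! ### Coding positions by sets. -/

section Coding

variable {B : Type u}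

/-- An injective coding of lists by sets. -/
noncomputable def codeList (e : B → ZFSet.{u}) : List B → ZFSet.{u}
  | [] => ∅
  | b :: l => ZFSet.pair (e b) (codeList e l)

theorem codeList_injective {e : B → ZFSet.{u}} (he : Function.Injective e) :
    Function.Injective (codeList e) := by
  have hne : ∀ x y : ZFSet.{u}, ZFSet.pair x y ≠ ∅ := fun x y h =>
    ZFSet.notMem_empty {x} (h ▸ by simp [ZFSet.pair])
  intro l
  induction l with
  | nil =>
    rintro (_ | ⟨b, l'⟩) h
    · rfl
    · exact (hne _ _ h.symm).elim
  | cons a l ih =>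
    rintro (_ | ⟨b, l'⟩) h
    · exact (hne _ _ h).elim
    · obtain ⟨h1, h2⟩ := ZFSet.pair_inj.1 h
      rw [he h1, ih h2]

/-- A set representing the position after the moves `p` and `l`, which is not among the `e b`. -/
noncomputable def positionTag (e : B → ZFSet.{u}) (p : B) (l : List B) : ZFSet.{u} :=
  ZFSet.pair (ZFSet.range e) (codeList e (p :: l))

theorem positionTag_inj {e : B → ZFSet.{u}} (he : Function.Injective e) {p p' : B}
    {l l' : List B} : positionTag e p l = positionTag e p' l' ↔ p = p' ∧ l = l' := by
  rw [positionTag, positionTag, ZFSet.pair_inj, (codeList_injective he).eq_iff]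
  simp

/-- The tag contains `ZFSet.range e` two membership levels down, so it outranks every `e b`. -/
theorem positionTag_ne (e : B → ZFSet.{u}) (p : B) (l : List B) (b : B) :
    positionTag e p l ≠ e b := by
  intro h
  have h1 : (positionTag e p l).rank < (ZFSet.range e).rank :=
    ZFSet.rank_lt_of_mem (h ▸ ZFSet.mem_range_self b)
  have h2 : (ZFSet.range e).rank < ({ZFSet.range e} : ZFSet).rank :=
    ZFSet.rank_lt_of_mem (by simp)
  have h3 : ({ZFSet.range e} : ZFSet).rank < (positionTag e p l).rank :=
    ZFSet.rank_lt_of_mem (by simp [positionTag, ZFSet.pair])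
  exact lt_irrefl _ (h1.trans (h2.trans h3))

end Coding

/-! ### The tree of positions of a winning strategy. -/

section Tree

variable {B : Type u} [CompleteBooleanAlgebra B]

/-- The element of `B` to which the last answer of II commits the outcome, after the moves `p` and
`l` of player I. -/
def StrategyII.commitment (σ : StrategyII B) (p : B) (l : List B) : B :=
  l.getLast?.elim p fun b => if σ p l = true then b else bᶜ

theorem outcome_le_commitment (σ : StrategyII B) (p : B) (b : ℕ → B) (n : ℕ) :
    outcome p b (σ.answers p b) ≤ σ.commitment p ((List.range n).map b) := by
  cases n with
  | zero => exact sdiff_le.trans inf_le_left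
  | succ n =>
    have hlast : ((List.range (n + 1)).map b).getLast? = some (b n) := by
      simp [List.range_succ]
    rw [StrategyII.commitment, hlast, Option.elim_some]
    split_ifs with h
    · exact sdiff_le.trans (inf_le_right.trans (iInf₂_le n h))
    · rw [outcome, sdiff_eq]
      refine inf_le_right.trans (compl_le_compl ?_)
      exact le_iSup₂_of_le n (Bool.eq_false_iff.2 h) le_rfl

/-- A chain of finite positions lies on a single infinite run. If the chain has bounded length, the
run continues with the default move. -/
theorem exists_forall_eq_map_range {α : Type*} [Inhabited α] {C : Set (List α)}
    (hC : ∀ l ∈ C, ∀ l' ∈ C, l <+: l' ∨ l' <+: l) :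
    ∃ b : ℕ → α, ∀ l ∈ C, l = (List.range l.length).map b := by
  classical
  have key : ∀ i, ∃ y, ∀ l ∈ C, ∀ h : i < l.length, l[i] = y := by
    intro i
    by_cases hi : ∃ l ∈ C, i < l.length
    · obtain ⟨l, hl, h⟩ := hi
      refine ⟨l[i], fun l' hl' h' => ?_⟩
      rcases hC l hl l' hl' with hp | hp
      · exact (hp.getElem h).symm
      · exact hp.getElem h'
    · exact ⟨default, fun l hl h => (hi ⟨l, hl, h⟩).elim⟩
  choose b hb using key
  refine ⟨b, fun l hl => List.ext_getElem (by simp) fun i h _ => ?_⟩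
  rw [hb i l hl h]
  simp

/-- The position after the moves `p` and `l` as a set: it consists of the commitments made so far
and of tags which ensure that inclusion is the order of extension of positions. -/
noncomputable def node (σ : StrategyII B) (e : B → ZFSet.{u}) (p : B) (l : List B) : ZFSet.{u} :=
  ZFSet.range (fun l' : {l' // l' <+: l} => positionTag e p l'.1) ∪
    ZFSet.range (fun l' : {l' // l' <+: l} => e (σ.commitment p l'.1))

variable {σ : StrategyII B} {e : B → ZFSet.{u}}

theorem mem_node {p : B} {l : List B} {x : ZFSet.{u}} : x ∈ node σ e p l ↔
    ∃ l', l' <+: l ∧ (x = positionTag e p l' ∨ x = e (σ.commitment p l')) := by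
  simp only [node, ZFSet.mem_union, ZFSet.mem_range, Subtype.exists, exists_prop, ← exists_or,
    ← and_or_left, eq_comm]

theorem node_subset_node_of_prefix {p : B} {l l' : List B} (h : l <+: l') :
    node σ e p l ⊆ node σ e p l' := by
  intro x hx
  obtain ⟨k, hk, hx⟩ := mem_node.1 hx
  exact mem_node.2 ⟨k, hk.trans h, hx⟩

theorem prefix_of_node_subset (he : Function.Injective e) {p p' : B} {l l' : List B}
    (h : node σ e p l ⊆ node σ e p' l') : p = p' ∧ l <+: l' := by
  have : positionTag e p l ∈ node σ e p' l' :=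
    h (mem_node.2 ⟨l, List.prefix_rfl, .inl rfl⟩)
  obtain ⟨k, hk, hx | hx⟩ := mem_node.1 this
  · obtain ⟨rfl, rfl⟩ := (positionTag_inj he).1 hx
    exact ⟨rfl, hk⟩
  · exact (positionTag_ne _ _ _ _ hx).elim

theorem mem_node_iff (he : Function.Injective e) {p : B} {l : List B} {b : B} :
    e b ∈ node σ e p l ↔ ∃ l', l' <+: l ∧ b = σ.commitment p l' := by
  rw [mem_node]
  refine exists_congr fun l' => and_congr_right fun _ => ?_
  rw [he.eq_iff, or_iff_right (positionTag_ne _ _ _ _).symm]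

variable (σ e) in
/-- The tree of all positions of the game in which II follows `σ`. -/
noncomputable def positionTree : ZFSet.{u} :=
  ZFSet.range fun j : {p : B // p ≠ ⊥} × List B => node σ e j.1.1 j.2

theorem mem_positionTree {s : ZFSet.{u}} :
    s ∈ positionTree σ e ↔ ∃ p l, p ≠ ⊥ ∧ node σ e p l = s := by
  simp only [positionTree, ZFSet.mem_range, Prod.exists, Subtype.exists]
  exact ⟨fun ⟨p, hp, l, h⟩ => ⟨p, l, hp, h⟩, fun ⟨p, l, hp, h⟩ => ⟨p, hp, l, h⟩⟩

theorem exists_decision (he : Function.Injective e) {s : ZFSet.{u}} (hs : s ∈ positionTree σ e)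
    (b : B) : ∃ t ∈ positionTree σ e, s ⊆ t ∧ ∃ c, e c ∈ t ∧ (c ≤ b ∨ c ≤ bᶜ) := by
  obtain ⟨p, l, hp, rfl⟩ := mem_positionTree.1 hs
  refine ⟨_, mem_positionTree.2 ⟨p, l ++ [b], hp, rfl⟩,
    node_subset_node_of_prefix (List.prefix_append _ _), σ.commitment p (l ++ [b]),
    (mem_node_iff he).2 ⟨_, List.prefix_rfl, rfl⟩, ?_⟩
  simp only [StrategyII.commitment, List.getLast?_append, List.getLast?_singleton, Option.some_or,
    Option.elim_some]
  split_ifs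
  · exact .inl le_rfl
  · exact .inr le_rfl

theorem exists_lower_bound (hσ : σ.IsWinning) (he : Function.Injective e) {p₀ : B} (hp₀ : p₀ ≠ ⊥)
    {C : ZFSet.{u}} (hC : C ⊆ positionTree σ e) (hchain : ∀ s ∈ C, ∀ t ∈ C, s ⊆ t ∨ t ⊆ s) :
    ∃ q : B, q ≠ ⊥ ∧ ∀ s ∈ C, ∀ b, e b ∈ s → q ≤ b := by
  rcases ZFSet.eq_empty_or_nonempty C with rfl | ⟨s₀, hs₀⟩
  -- The empty chain singles out no first move, so `p₀` serves as its bound.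
  · exact ⟨p₀, hp₀, fun s hs => (ZFSet.notMem_empty _ hs).elim⟩
  obtain ⟨p, l₀, hp, rfl⟩ := mem_positionTree.1 (hC hs₀)
  have : Inhabited B := ⟨⊥⟩
  obtain ⟨b, hb⟩ := exists_forall_eq_map_range (C := {l | node σ e p l ∈ C}) fun l hl l' hl' =>
    (hchain _ hl _ hl').imp (fun h => (prefix_of_node_subset he h).2)
      fun h => (prefix_of_node_subset he h).2
  refine ⟨_, hσ p hp b, fun s hs c hc => ?_⟩
  obtain ⟨p', l, -, rfl⟩ := mem_positionTree.1 (hC hs)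
  have hpp : p' = p := by
    rcases hchain _ hs _ hs₀ with h | h
    · exact (prefix_of_node_subset he h).1
    · exact (prefix_of_node_subset he h).1.symm
  subst hpp
  obtain ⟨l', hl', rfl⟩ := (mem_node_iff he).1 hc
  have e1 : l' = (List.range l'.length).map b := by
    have h1 := hb l hs
    rw [List.prefix_iff_eq_take.1 hl', h1, ← List.map_take, List.take_range]
    simp
  rw [e1]
  exact outcome_le_commitment σ p' b _

end Tree

end CutChoose

namespace CutChoose

open Cardinal Ordinal FirstOrder

/-! ### Strategy trees in elementary submodels. -/

section StrategyTree

variable {θ : Cardinal.{u}}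

/-- `p` is a nonzero element of the Boolean algebra with the order relation `a`. -/
def IsNonzero (p a : H θ) : Prop :=
  ZFSet.pair p.1 p.1 ∈ a.1 ∧ ∃ c : H θ, ZFSet.pair c.1 c.1 ∈ a.1 ∧ ¬ ZFSet.pair p.1 c.1 ∈ a.1

theorem isFirstOrder_isNonzero {Γ : Type} (i j : Γ) :
    IsFirstOrder fun v : Γ → H θ => IsNonzero (v i) (v j) :=
  .and (isFirstOrder_pair_mem _ _ _)
    (.ex (.and (isFirstOrder_pair_mem _ _ _) (isFirstOrder_pair_mem _ _ _).not))

/-- `P` is, as far as `H θ` can see, a set of positions by which II wins the cut and choose game on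
the Boolean algebra with the order relation `a`: each nonzero `p` occurs in a position, positions
can be extended to decide any given `b`, and each chain of positions has a nonzero lower bound. -/
def IsStrategyTree (P a : H θ) : Prop :=
  (∀ p : H θ, IsNonzero p a → ∃ s : H θ, s.1 ∈ P.1 ∧ p.1 ∈ s.1) ∧
  (∀ s b : H θ, s.1 ∈ P.1 → ZFSet.pair b.1 b.1 ∈ a.1 →
    ∃ t : H θ, t.1 ∈ P.1 ∧ s.1 ⊆ t.1 ∧ ∃ c : H θ, c.1 ∈ t.1 ∧ ZFSet.pair c.1 c.1 ∈ a.1 ∧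
      (ZFSet.pair c.1 b.1 ∈ a.1 ∨ ∀ d : H θ, ZFSet.pair d.1 c.1 ∈ a.1 →
        ZFSet.pair d.1 b.1 ∈ a.1 → ¬ IsNonzero d a)) ∧
  (∀ C : H θ, (∀ s : H θ, s.1 ∈ C.1 → s.1 ∈ P.1) →
    (∀ s t : H θ, s.1 ∈ C.1 → t.1 ∈ C.1 → s.1 ⊆ t.1 ∨ t.1 ⊆ s.1) →
    ∃ q : H θ, IsNonzero q a ∧ ∀ s x : H θ, s.1 ∈ C.1 → x.1 ∈ s.1 → ZFSet.pair x.1 x.1 ∈ a.1 →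
      ZFSet.pair q.1 x.1 ∈ a.1)

theorem isFirstOrder_isStrategyTree {Γ : Type} (i j : Γ) :
    IsFirstOrder fun v : Γ → H θ => IsStrategyTree (v i) (v j) := by
  refine .and ?_ (.and ?_ ?_)
  · exact .all (.imp (isFirstOrder_isNonzero _ _) (.ex (.and (.mem _ _) (.mem _ _))))
  · exact .all (.all (.imp (.mem _ _) (.imp (isFirstOrder_pair_mem _ _ _) (.ex (.and (.mem _ _)
      (.and (isFirstOrder_subset _ _) (.ex (.and (.mem _ _) (.and (isFirstOrder_pair_mem _ _ _)
      (.or (isFirstOrder_pair_mem _ _ _) (.all (.imp (isFirstOrder_pair_mem _ _ _)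
      (.imp (isFirstOrder_pair_mem _ _ _) (isFirstOrder_isNonzero _ _).not)))))))))))))
  · exact .all (.imp (.all (.imp (.mem _ _) (.mem _ _)))
      (.imp (.all (.all (.imp (.mem _ _) (.imp (.mem _ _)
        (.or (isFirstOrder_subset _ _) (isFirstOrder_subset _ _))))))
      (.ex (.and (isFirstOrder_isNonzero _ _) (.all (.all (.imp (.mem _ _) (.imp (.mem _ _)
        (.imp (isFirstOrder_pair_mem _ _ _) (isFirstOrder_pair_mem _ _ _))))))))))

variable {B : Type u} {e : B → ZFSet.{u}}

theorem pair_mem_codeName {f : Set.Iio (ω₁ : Ordinal.{u}) → B} {x y : ZFSet.{u}} :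
    ZFSet.pair x y ∈ codeName e f ↔ ∃ α, α.1.toZFSet = x ∧ e (f α) = y := by
  simp only [codeName, ZFSet.mem_range, ZFSet.pair_inj]

variable [CompleteBooleanAlgebra B]

theorem pair_mem_codeAlgebra {x y : ZFSet.{u}} :
    ZFSet.pair x y ∈ codeAlgebra e ↔ ∃ b c, b ≤ c ∧ e b = x ∧ e c = y := by
  simp only [codeAlgebra, ZFSet.mem_range, ZFSet.pair_inj]
  exact ⟨fun ⟨b, h⟩ => ⟨b.1.1, b.1.2, b.2, h⟩, fun ⟨b, c, hbc, h⟩ => ⟨⟨(b, c), hbc⟩, h⟩⟩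

theorem pair_mem_codeAlgebra_iff_le (he : Function.Injective e) {b c : B} :
    ZFSet.pair (e b) (e c) ∈ codeAlgebra e ↔ b ≤ c := by
  rw [pair_mem_codeAlgebra]
  constructor
  · rintro ⟨b', c', h, hb, hc⟩
    rwa [← he hb, ← he hc]
  · exact fun h => ⟨b, c, h, rfl, rfl⟩

theorem pair_self_mem_codeAlgebra {x : ZFSet.{u}} :
    ZFSet.pair x x ∈ codeAlgebra e ↔ ∃ b, e b = x := by
  rw [pair_mem_codeAlgebra]
  constructor
  · rintro ⟨b, _, _, h, _⟩
    exact ⟨b, h⟩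
  · rintro ⟨b, h⟩
    exact ⟨b, b, le_rfl, h, h⟩

theorem code_mem_H (ha : codeAlgebra e ∈ H θ) (b : B) : e b ∈ H θ :=
  (mem_H_of_pair_mem ha (pair_self_mem_codeAlgebra.2 ⟨b, rfl⟩)).1

theorem isNonzero_iff (he : Function.Injective e) {ha : codeAlgebra e ∈ H θ} {x : H θ} :
    IsNonzero x ⟨codeAlgebra e, ha⟩ ↔ ∃ b, b ≠ ⊥ ∧ e b = x.1 := by
  constructor
  · rintro ⟨hx, c, hc, hxc⟩
    obtain ⟨b, hb⟩ := pair_self_mem_codeAlgebra.1 hx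
    obtain ⟨c', hc'⟩ := pair_self_mem_codeAlgebra.1 hc
    rw [← hb, ← hc', pair_mem_codeAlgebra_iff_le he] at hxc
    exact ⟨b, fun h => hxc (h ▸ bot_le), hb⟩
  · rintro ⟨b, hb, hx⟩
    refine ⟨pair_self_mem_codeAlgebra.2 ⟨b, hx⟩, ⟨e ⊥, code_mem_H ha ⊥⟩,
      pair_self_mem_codeAlgebra.2 ⟨⊥, rfl⟩, ?_⟩
    rw [← hx, pair_mem_codeAlgebra_iff_le he, le_bot_iff]
    exact hb

theorem isStrategyTree_positionTree {σ : StrategyII B} (hσ : σ.IsWinning)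
    (he : Function.Injective e) (ha : codeAlgebra e ∈ H θ) (hP : positionTree σ e ∈ H θ)
    {p₀ : B} (hp₀ : p₀ ≠ ⊥) : IsStrategyTree ⟨positionTree σ e, hP⟩ ⟨codeAlgebra e, ha⟩ := by
  refine ⟨fun p hp => ?_, fun s b hs hb => ?_, fun C hC hchain => ?_⟩
  · obtain ⟨b, hb, hbp⟩ := (isNonzero_iff he).1 hp
    have hmem : node σ e b [] ∈ positionTree σ e := mem_positionTree.2 ⟨b, [], hb, rfl⟩
    exact ⟨⟨_, mem_H_of_mem hP hmem⟩, hmem, hbp ▸ (mem_node_iff he).2 ⟨[], List.prefix_rfl, rfl⟩⟩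
  · obtain ⟨b', hb'⟩ := pair_self_mem_codeAlgebra.1 hb
    obtain ⟨t, ht, hst, c, hc, hcb⟩ := exists_decision he hs b'
    refine ⟨⟨t, mem_H_of_mem hP ht⟩, ht, hst, ⟨e c, code_mem_H ha c⟩, hc,
      pair_self_mem_codeAlgebra.2 ⟨c, rfl⟩, ?_⟩
    simp only [← hb']
    refine hcb.imp (pair_mem_codeAlgebra_iff_le he).2 fun hcb d hdc hdb hd => ?_
    obtain ⟨d', hd', hdd⟩ := (isNonzero_iff he).1 hd
    rw [← hdd, pair_mem_codeAlgebra_iff_le he] at hdc hdb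
    exact hd' (disjoint_self.1 ((le_compl_iff_disjoint_right.1 hcb).mono hdc hdb))
  · obtain ⟨q, hq, h⟩ := exists_lower_bound hσ he hp₀ (C := C.1)
      (fun s hs => hC ⟨s, mem_H_of_mem C.2 hs⟩ hs)
      fun s hs t ht => hchain ⟨s, mem_H_of_mem C.2 hs⟩ ⟨t, mem_H_of_mem C.2 ht⟩ hs ht
    refine ⟨⟨e q, code_mem_H ha q⟩, (isNonzero_iff he).2 ⟨q, hq, rfl⟩, fun s x hs hx hxa => ?_⟩
    obtain ⟨b, hb⟩ := pair_self_mem_codeAlgebra.1 hxa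
    rw [← hb, pair_mem_codeAlgebra_iff_le he]
    exact h s.1 hs b (hb ▸ hx)

namespace IsStrategyTree

variable {P : H θ} {ha : codeAlgebra e ∈ H θ}

theorem exists_mem (h : IsStrategyTree P ⟨codeAlgebra e, ha⟩) (he : Function.Injective e) {p : B}
    (hp : p ≠ ⊥) : ∃ s : H θ, s.1 ∈ P.1 ∧ e p ∈ s.1 :=
  h.1 ⟨e p, code_mem_H ha p⟩ ((isNonzero_iff he).2 ⟨p, hp, rfl⟩)

theorem exists_decision (h : IsStrategyTree P ⟨codeAlgebra e, ha⟩) (he : Function.Injective e)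
    (s : H θ) (hs : s.1 ∈ P.1) (b : B) :
    ∃ t : H θ, t.1 ∈ P.1 ∧ s.1 ⊆ t.1 ∧ ∃ c, e c ∈ t.1 ∧ (c ≤ b ∨ c ≤ bᶜ) := by
  obtain ⟨t, ht, hst, c, hc, hca, hcb⟩ := h.2.1 s ⟨e b, code_mem_H ha b⟩ hs
    (pair_self_mem_codeAlgebra.2 ⟨b, rfl⟩)
  obtain ⟨c', hc'⟩ := pair_self_mem_codeAlgebra.1 hca
  refine ⟨t, ht, hst, c', hc' ▸ hc, hcb.imp (fun h => ?_) fun h => ?_⟩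
  · rwa [← hc', pair_mem_codeAlgebra_iff_le he] at h
  · rw [le_compl_iff_disjoint_right, disjoint_iff]
    by_contra hne
    refine h ⟨e (c' ⊓ b), code_mem_H ha _⟩ ?_ ?_ ((isNonzero_iff he).2 ⟨_, hne, rfl⟩)
    · rw [← hc', pair_mem_codeAlgebra_iff_le he]
      exact inf_le_left
    · rw [pair_mem_codeAlgebra_iff_le he]
      exact inf_le_right

theorem exists_lower_bound (h : IsStrategyTree P ⟨codeAlgebra e, ha⟩) (he : Function.Injective e)
    (u : ℕ → ZFSet.{u}) (hu : Monotone u) (huP : ∀ n, u n ∈ P.1) :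
    ∃ q : B, q ≠ ⊥ ∧ ∀ n b, e b ∈ u n → q ≤ b := by
  -- Any subset of `P` is in `H θ`, so the chain condition also covers sequences that are not in
  -- `N`.
  have hC : ZFSet.range u ∈ H θ := mem_H_of_subset P.2 fun x hx => by
    obtain ⟨n, rfl⟩ := ZFSet.mem_range.1 hx
    exact huP n
  obtain ⟨q, hq, hqu⟩ := h.2.2 ⟨_, hC⟩
    (fun s hs => by
      obtain ⟨n, hn⟩ := ZFSet.mem_range.1 hs
      exact hn ▸ huP n)
    (fun s t hs ht => by
      obtain ⟨n, hn⟩ := ZFSet.mem_range.1 hs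
      obtain ⟨m, hm⟩ := ZFSet.mem_range.1 ht
      rw [← hn, ← hm]
      exact (le_total n m).imp (fun h => hu h) fun h => hu h)
  obtain ⟨q', hq', hqq⟩ := (isNonzero_iff he).1 hq
  refine ⟨q', hq', fun n b hb => ?_⟩
  have := hqu ⟨u n, mem_H_of_mem P.2 (huP n)⟩ ⟨e b, code_mem_H ha b⟩ (ZFSet.mem_range.2 ⟨n, rfl⟩) hb
    (pair_self_mem_codeAlgebra.2 ⟨b, rfl⟩)
  rwa [← hqq, pair_mem_codeAlgebra_iff_le he] at this

theorem exists_value (h : IsStrategyTree P ⟨codeAlgebra e, ha⟩) (he : Function.Injective e)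
    {f : Set.Iio (ω₁ : Ordinal.{u}) → B} (hf : IsCountableOrdinalName f) (s : H θ)
    (hs : s.1 ∈ P.1) :
    ∃ t : H θ, t.1 ∈ P.1 ∧ s.1 ⊆ t.1 ∧ ∃ α c, e c ∈ t.1 ∧ c ≤ f α := by
  obtain ⟨x, hx, hbern⟩ := exists_bernstein
  -- As `ℵ₁ ≤ 𝔠`, the countable ordinals can be coded by distinct points of the Bernstein set.
  have hcard : Cardinal.lift.{0} #(Set.Iio (ω₁ : Ordinal.{u})) ≤
      Cardinal.lift.{u + 1} #(ℕ → Bool) := by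
    simp [Cardinal.mk_Iio_ordinal, aleph0_lt_continuum]
  obtain ⟨i⟩ := Cardinal.lift_mk_le'.1 hcard
  obtain ⟨t, hst, α, c, hc, hcα⟩ := exists_extension_le (S := {s : ZFSet.{u} // s ∈ P.1})
    (x := fun α => x (i α)) (fun t => {b | e b ∈ t.1}) (fun t t' (h : t.1 ⊆ t'.1) _ hb => h hb)
    (fun u hu => h.exists_lower_bound he (fun n => (u n).1) (fun _ _ h => hu h) fun n => (u n).2)
    (fun t b => by
      obtain ⟨t', ht', hle, h'⟩ := h.exists_decision he ⟨t.1, mem_H_of_mem P.2 t.2⟩ t.2 b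
      exact ⟨⟨t'.1, ht'⟩, hle, h'⟩)
    hf.disjoint hf.iSup_eq_top (hx.comp i.injective)
    (fun E hE => (hbern E hE).imp fun z hz y => hz _) ⟨s.1, hs⟩
  exact ⟨⟨t.1, mem_H_of_mem P.2 t.2⟩, t.2, hst, α, c, hc, hcα⟩

end IsStrategyTree

theorem IsStrategyTree.exists_value_mem {P : H θ} {ha : codeAlgebra e ∈ H θ}
    (h : IsStrategyTree P ⟨codeAlgebra e, ha⟩) (he : Function.Injective e)
    (N : setLang.ElementarySubstructure (H θ)) (haN : ⟨codeAlgebra e, ha⟩ ∈ N) (hPN : P ∈ N)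
    {f : Set.Iio (ω₁ : Ordinal.{u}) → B} (hf : IsCountableOrdinalName f)
    (hfN : codeName e f ∈ elems N) (s : H θ) (hs : s.1 ∈ P.1) (hsN : s ∈ N) :
    ∃ t ∈ N, t.1 ∈ P.1 ∧ s.1 ⊆ t.1 ∧
      ∃ α, α.1.toZFSet ∈ elems N ∧ ∃ c, e c ∈ t.1 ∧ c ≤ f α := by
  obtain ⟨F, hFN, hF⟩ := hfN
  let a : H θ := ⟨codeAlgebra e, ha⟩
  obtain ⟨t, ht, hst, α, c, hc, hcα⟩ := h.exists_value he hf s hs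
  have hpair : ZFSet.pair α.1.toZFSet (e (f α)) ∈ F.1 := hF ▸ pair_mem_codeName.2 ⟨α, rfl, rfl⟩
  -- Elementarity is applied twice: `hext` gives a position in `N`, then `hvalue` gives an ordinal
  -- in `N` with that position as a further parameter. The indices in `Fin 4` stand for `P`, `s`,
  -- the name and the algebra.
  have hvalue : IsFirstOrder fun w : Option (Option (Fin 4)) → H θ => ∃ b c : H θ,
      ZFSet.pair (w none).1 b.1 ∈ (w (some (some 2))).1 ∧ c.1 ∈ (w (some none)).1 ∧
        ZFSet.pair c.1 b.1 ∈ (w (some (some 3))).1 :=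
    .ex (.ex (.and (isFirstOrder_pair_mem _ _ _) (.and (.mem _ _) (isFirstOrder_pair_mem _ _ _))))
  have hext : IsFirstOrder fun w : Option (Fin 4) → H θ =>
      ((w none).1 ∈ (w (some 0)).1 ∧ (w (some 1)).1 ⊆ (w none).1) ∧ ∃ α b c : H θ,
        ZFSet.pair α.1 b.1 ∈ (w (some 2)).1 ∧ c.1 ∈ (w none).1 ∧
          ZFSet.pair c.1 b.1 ∈ (w (some 3)).1 :=
    .and (.and (.mem _ _) (isFirstOrder_subset _ _)) (.ex (.ex (.ex
      (.and (isFirstOrder_pair_mem _ _ _) (.and (.mem _ _) (isFirstOrder_pair_mem _ _ _))))))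
  have hv : ∀ i, ![P, s, F, a] i ∈ N := by
    intro i
    fin_cases i
    exacts [hPN, hsN, hFN, haN]
  obtain ⟨t', ht'N, ⟨ht'P, hst'⟩, β, hβ⟩ := hext.exists_mem N ![P, s, F, a] hv t
    ⟨⟨ht, hst⟩, ⟨_, (mem_H_of_pair_mem F.2 hpair).1⟩, ⟨_, (mem_H_of_pair_mem F.2 hpair).2⟩,
      ⟨_, code_mem_H ha c⟩, hpair, hc, (pair_mem_codeAlgebra_iff_le he).2 hcα⟩
  obtain ⟨γ, hγN, b, c', hb, hc', hcb⟩ := hvalue.exists_mem N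
    (fun o => o.elim t' ![P, s, F, a]) (by rintro (_ | i); exacts [ht'N, hv i]) β hβ
  change ZFSet.pair γ.1 b.1 ∈ F.1 at hb
  rw [hF, pair_mem_codeName] at hb
  obtain ⟨δ, hδ, hδb⟩ := hb
  obtain ⟨c'', b'', hle, hc'', hb''⟩ := pair_mem_codeAlgebra.1 hcb
  refine ⟨t', ht'N, ht'P, hst', δ, ⟨γ, hγN, hδ.symm⟩, c'', hc'' ▸ hc', ?_⟩
  rwa [← he (hb''.trans hδb.symm)]

theorem exists_isSemigeneric {σ : StrategyII B} (hσ : σ.IsWinning) (he : Function.Injective e)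
    (hP : positionTree σ e ∈ H θ) (N : setLang.ElementarySubstructure (H θ))
    (hN : (elems N).Countable) (haN : codeAlgebra e ∈ elems N) {p : B} (hp : p ≠ ⊥)
    (hpN : e p ∈ elems N) : ∃ q : B, q ≠ ⊥ ∧ q ≤ p ∧ IsSemigeneric e (elems N) q := by
  obtain ⟨⟨_, ha⟩, haN, rfl⟩ := haN
  obtain ⟨x, hxN, hx⟩ := hpN
  have htree := isStrategyTree_positionTree hσ he ha hP hp
  -- The tree of `σ` only witnesses that a strategy tree exists; from here on it is replaced by a
  -- tree `P` in `N`.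
  obtain ⟨P, hPN, hP'⟩ := (isFirstOrder_isStrategyTree (none : Option (Fin 1)) (some 0)).exists_mem
    N (fun _ => ⟨codeAlgebra e, ha⟩) (fun _ => haN) _ htree
  change IsStrategyTree P ⟨codeAlgebra e, ha⟩ at hP'
  obtain ⟨s, hs, hps⟩ := hP'.exists_mem he hp
  have hstart : IsFirstOrder fun w : Option (Fin 2) → H θ =>
      (w none).1 ∈ (w (some 0)).1 ∧ (w (some 1)).1 ∈ (w none).1 := .and (.mem _ _) (.mem _ _)
  obtain ⟨s₀, hs₀N, hs₀P, hps₀⟩ := hstart.exists_mem N ![P, x]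
    (by intro i; fin_cases i; exacts [hPN, hxN]) s ⟨hs, hx ▸ hps⟩
  change x.1 ∈ s₀.1 at hps₀
  obtain ⟨g, hg⟩ := hN.exists_eq_range ⟨x.1, x, hxN, rfl⟩
  let S := {s : H θ // s ∈ N ∧ s.1 ∈ P.1}
  let R : ℕ → S → Prop := fun n t =>
    ∀ f : Set.Iio (ω₁ : Ordinal.{u}) → B, IsCountableOrdinalName f → codeName e f = g n →
      ∃ α, α.1.toZFSet ∈ elems N ∧ ∃ c, e c ∈ t.1.1 ∧ c ≤ f α
  have hR : ∀ n (s : S), ∃ t, s ≤ t ∧ R n t := by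
    rintro n ⟨s, hsN, hsP⟩
    by_cases hex : ∃ f : Set.Iio (ω₁ : Ordinal.{u}) → B,
        IsCountableOrdinalName f ∧ codeName e f = g n
    · obtain ⟨f, hf, hfn⟩ := hex
      have hfN : codeName e f ∈ elems N := by rw [hfn, hg]; exact ⟨n, rfl⟩
      obtain ⟨t, htN, htP, hst, α, hα, c, hc, hcα⟩ :=
        hP'.exists_value_mem he N haN hPN hf hfN s hsP hsN
      refine ⟨⟨t, htN, htP⟩, hst, fun f' _ hf' => ?_⟩
      -- `R` speaks of every name with the code `g n`; the code contains the pair for `α`, so the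
      -- value found for `f` also serves `f'`.
      obtain ⟨β, hβ, hβf⟩ := pair_mem_codeName.1
        (hf'.trans hfn.symm ▸ pair_mem_codeName.2 ⟨α, rfl, rfl⟩ :
          ZFSet.pair α.1.toZFSet (e (f α)) ∈ codeName e f')
      exact ⟨β, hβ ▸ hα, c, hc, (he hβf).symm ▸ hcα⟩
    · exact ⟨⟨s, hsN, hsP⟩, le_rfl, fun f hf hfn => (hex ⟨f, hf, hfn⟩).elim⟩
  obtain ⟨u, hu0, hu, huR⟩ := exists_monotone_run R hR ⟨s₀, hs₀N, hs₀P⟩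
  obtain ⟨q, hq, hqu⟩ := hP'.exists_lower_bound he (fun n => (u n).1.1) (fun _ _ h => hu h)
    fun n => (u n).2.2
  refine ⟨q, hq, hqu 0 p ?_, fun f hf hfN => ?_⟩
  · simp only [hu0]
    rwa [← hx]
  · rw [hg] at hfN
    obtain ⟨n, hn⟩ := hfN
    obtain ⟨α, hα, c, hc, hcα⟩ := huR n f hf hn.symm
    exact ((hqu _ c hc).trans hcα).trans (le_iSup₂_of_le α hα le_rfl)

end StrategyTree

end CutChoose

theorem theorem1 (B : Type u) [CompleteBooleanAlgebra B]
    (h : ∃ σ : CutChoose.StrategyII B, σ.IsWinning) : CutChoose.IsSemiproper B := by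
  obtain ⟨σ, hσ⟩ := h
  intro e he
  obtain ⟨θ₀, hθ₀⟩ := CutChoose.exists_forall_mem_H (CutChoose.positionTree σ e)
  exact ⟨θ₀, fun θ hθ _ N hN haN p hp hpN =>
    CutChoose.exists_isSemigeneric hσ he (hθ₀ θ hθ) N hN haN hp hpN⟩
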